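/- **Setting.** Let $m\ge 1$. An $m$-user index coding instance consists of a source $\mathbf S=(S_1,\dots,S_s)$ of i.i.d. Bernoulli$(1/2)$ bits and, for each decoder $i\in[m]=\{1,\dots,m\}$, a set $\mathbf f_i$ of demanded source bits and a set $\mathbf Y_i$ of source bits available as side information. It is assumed that $\mathbf f_i\cap\mathbf Y_i=\emptyset$ for all $i$, that $\mathbf Y_i\neq\mathbf Y_j$ for $i\ne j$, and that every source bit is demanded by at least one decoder. Sets of source bits are identified with the corresponding sub-vectors of $\mathbf S$, and entropies $H$ are in bits. An $(n,M)$ code consists of an encoder mapping $n$ i.i.d. copies $\mathbf S^n$ of the source to $\{1,\dots,M\}$ and, for each $i$, a decoder that maps the encoder output and $\mathbf Y_i^n$ to an estimate of $\mathbf f_i^n$. Its error probability is the probability that at least one decoder's estimate differs from $\mathbf f_i^n$. A rate $R$ is achievable if there is a sequence of $(n,M_n)$ codes with $n^{-1}\log_2 M_n\le R$ whose error probability tends to $0$ as $n\to\infty$. The optimal rate is $R_{opt}=\inf\{R: R\text{ is achievable}\}$. *Step 1 of CAPM.* For each source bit $b$ let $K$ be the set of decoders that demand $b$ and $J$ the set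 of decoders that do not have $b$ as side information. Put $b$ in the message $U_{K\cup([m]\setminus J)}$ if $J\ne[m]$, and in $U_{[m]}$ if $J=[m]$. The rate of the resulting allocation $(U_I)_{I\subseteq[m]}$ is $$R_{\mathrm{Step\,1}}=\sum_{\emptyset\ne I\subseteq[m]}\ \max_{i\in I}H(U_I\mid\mathbf Y_i).$$ *Excess bits.* For a message $U_I$ with $I\neq[m]$, let $i^*$ (respectively $j^*$) be the smallest index in $I$ that minimizes (respectively maximizes) $l\mapsto H(U_I\mid\mathbf Y_l)$ over $l\in I$. If $H(U_I\mid\mathbf Y_{i^*})<H(U_I\mid\mathbf Y_{j^*})$, then the lowest-index bit of $U_I$ that lies in $\mathbf Y_{i^*}$ but not in $\mathbf Y_{j^*}$ is an excess bit. There are no excess bits after Step 1 if no message $U_I$ with $I\ne[m]$ produced by Step 1 has an excess bit. **Proposition.** Suppose that an $m$-user index coding instance has no excess bits after Step 1 of CAPM. Then the rate obtained by following only Step 1 is optimal, $R_{\mathrm{Step\,1}}=R_{opt}$, and $$R_{opt}=\max_{\pi}\Big\{H(\mathbf f_{\pi(1)}\mid\mathbf Y_{\pi(1)})+H(\mathbf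 f_{\pi(2)}\mid\mathbf f_{\pi(1)},\mathbf Y_{\pi(1)},\mathbf Y_{\pi(2)})+\cdots+H(\mathbf f_{\pi(m)}\mid\mathbf f_{\pi(1)},\mathbf Y_{\pi(1)},\dots,\mathbf f_{\pi(m-1)},\mathbf Y_{\pi(m-1)},\mathbf Y_{\pi(m)})\Big\},$$ where $\pi$ ranges over the $m$ permutations $(1,2,\dots,m),(2,1,3,\dots,m),\dots,(m,1,\dots,m-1)$ of $[m]$, that is, for each $k\in[m]$ the permutation that lists $k$ first and then the remaining indices in increasing order. -/

import Mathlib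

open Filter Topology

noncomputable section

namespace IndexCoding

/-! ### Probability and entropy on a finite sample space with the uniform law -/

open Classical in
/-- Probability of the event `E` under the uniform law on a finite sample space `Ω`.
For `Ω = Fin s → Bool` this is the law of `s` i.i.d. Bernoulli(1/2) bits, and for
`Ω = Fin n → Fin s → Bool` that of `n` i.i.d. copies of such a vector. -/
def prob {Ω : Type*} [Fintype Ω] (E : Ω → Prop) : ℝ :=
  ((Finset.univ.filter E).card : ℝ) / (Fintype.card Ω : ℝ)

/-- Conditional Shannon entropy `H(X | Y)` in bits,
`- ∑_{y, x} P(X = x, Y = y) log₂ P(X = x | Y = y)`. -/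
def condEntropy {Ω α β : Type*} [Fintype Ω] [Fintype α] [Fintype β]
    (X : Ω → α) (Y : Ω → β) : ℝ :=
  ∑ y : β, ∑ x : α, -(prob (fun w => X w = x ∧ Y w = y) *
    Real.logb 2 (prob (fun w => X w = x ∧ Y w = y) / prob (fun w => Y w = y)))

/-- `H(A | B)` for sets `A`, `B` of source bits, viewed as sub-vectors of the source
`S = (S_1, …, S_s)` of i.i.d. Bernoulli(1/2) bits. A tuple of sub-vectors is identified with the
sub-vector on the union of the index sets. -/
def bitEntropy {s : ℕ} (A B : Finset (Fin s)) : ℝ :=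
  condEntropy (Ω := Fin s → Bool) (fun x => A.restrict x) (fun x => B.restrict x)

/-! ### The index coding problem -/

/-- An index coding instance with `m` decoders and `s` source bits. -/
structure Instance (m s : ℕ) where
  /-- the source bits demanded by decoder `i` -/
  demand : Fin m → Finset (Fin s)
  /-- the source bits that decoder `i` has as side information -/
  side : Fin m → Finset (Fin s)
  /-- no decoder demands a bit of its own side information -/
  demand_disjoint_side : ∀ i, Disjoint (demand i) (side i)
  /-- distinct decoders have distinct side information -/
  side_injective : Function.Injective side
  /-- every source bit is demanded by at least one decoder -/
  exists_demand : ∀ b, ∃ i, b ∈ demand i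

variable {m s : ℕ}

/-- An `(n, M)` code: one encoder that sees `n` source vectors, and for each decoder a decoding
function of the message and of the decoder's own side information. -/
structure Code (P : Instance m s) (n M : ℕ) where
  /-- the encoding function -/
  enc : (Fin n → Fin s → Bool) → Fin M
  /-- the decoding functions -/
  dec : (i : Fin m) → Fin M → (Fin n → P.side i → Bool) → (Fin n → P.demand i → Bool)

/-- The block error probability: at least one decoder fails to reproduce its demand. -/
def Code.errorProb {P : Instance m s} {n M : ℕ} (c : Code P n M) : ℝ :=
  prob (fun x : Fin n → Fin s → Bool =>
    ∃ i : Fin m, c.dec i (c.enc x) (fun t => (P.side i).restrict (x t)) ≠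
      fun t => (P.demand i).restrict (x t))

/-- The rate `R` is achievable: there is a sequence of `(n, M_n)` codes with
`n⁻¹ log₂ M_n ≤ R` whose block error probability tends to zero. -/
def Achievable (P : Instance m s) (R : ℝ) : Prop :=
  ∃ (M : ℕ → ℕ) (c : (n : ℕ) → Code P n (M n)),
    (∀ n : ℕ, 1 ≤ n → Real.logb 2 (M n) / (n : ℝ) ≤ R) ∧
    Tendsto (fun n => (c n).errorProb) atTop (𝓝 0)

/-- The optimal rate, `inf {R | R is achievable}`. -/
def optimalRate (P : Instance m s) : ℝ :=
  sInf {R : ℝ | Achievable P R}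

/-! ### Step 1, excess bits, rate of an allocation -/

/-- The set `K` of the decoders that demand bit `b`. -/
def demanders (P : Instance m s) (b : Fin s) : Finset (Fin m) :=
  Finset.univ.filter (fun i => b ∈ P.demand i)

/-- The set `J` of the decoders that do not have bit `b` as side information. -/
def lackers (P : Instance m s) (b : Fin s) : Finset (Fin m) :=
  Finset.univ.filter (fun i => b ∉ P.side i)

/-- The index set of the message into which Step 1 puts bit `b`: `K ∪ Jᶜ` if `J ≠ [m]`, and `[m]`
if `J = [m]`. -/
def step1Index (P : Instance m s) (b : Fin s) : Finset (Fin m) :=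
  if lackers P b = Finset.univ then Finset.univ else demanders P b ∪ (lackers P b)ᶜ

/-- The allocation after Step 1: the message `U_I` consists of all bits sent to index set `I`. -/
def step1 (P : Instance m s) (I : Finset (Fin m)) : Finset (Fin s) :=
  Finset.univ.filter (fun b => step1Index P b = I)

/-- The rate `∑_I max_{i ∈ I} H(U_I | Y_i)` of an allocation `U` of source bits to messages. -/
def allocRate (P : Instance m s) (U : Finset (Fin m) → Finset (Fin s)) : ℝ :=
  ∑ I : {I : Finset (Fin m) // I.Nonempty},
    I.1.sup' I.2 (fun i => bitEntropy (U I.1) (P.side i))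

/-- `b` is an excess bit of the message `U_I`, that is, the bit that Step 2 moves out of `U_I` when
it comes upon it: `I ≠ [m]`; the least-index minimizer `i` and the least-index maximizer `j` of
`l ↦ H(U_I | Y_l)` over `I` have `H(U_I | Y_i) < H(U_I | Y_j)`; and `b` is the lowest-index bit of
`U_I` that is in `Y_i` and not in `Y_j`. -/
def IsExcessBit (P : Instance m s) (U : Finset (Fin m) → Finset (Fin s))
    (I : Finset (Fin m)) (b : Fin s) : Prop :=
  I ≠ Finset.univ ∧ ∃ i j : Fin m,
    IsLeast {i | i ∈ I ∧ ∀ l ∈ I, bitEntropy (U I) (P.side i) ≤ bitEntropy (U I) (P.side l)} i ∧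
    IsLeast {j | j ∈ I ∧ ∀ l ∈ I, bitEntropy (U I) (P.side l) ≤ bitEntropy (U I) (P.side j)} j ∧
    bitEntropy (U I) (P.side i) < bitEntropy (U I) (P.side j) ∧
    IsLeast {b | b ∈ U I ∧ b ∈ P.side i ∧ b ∉ P.side j} b

/-- There are no excess bits after Step 1 (so that Step 2 moves nothing). -/
def NoExcessAfterStep1 (P : Instance m s) : Prop :=
  ∀ (I : Finset (Fin m)) (b : Fin s), ¬ IsExcessBit P (step1 P) I b

/-! ### The entropy expression of a permutation -/

/-- `H(f_{σ(1)} | Y_{σ(1)}) + H(f_{σ(2)} | f_{σ(1)}, Y_{σ(1)}, Y_{σ(2)}) + ⋯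
  + H(f_{σ(m)} | f_{σ(1)}, Y_{σ(1)}, …, f_{σ(m-1)}, Y_{σ(m-1)}, Y_{σ(m)})`. -/
def permBound (P : Instance m s) (σ : Equiv.Perm (Fin m)) : ℝ :=
  ∑ k : Fin m, bitEntropy (P.demand (σ k))
    ((Finset.Iio k).biUnion (fun j => P.demand (σ j)) ∪
      (Finset.Iic k).biUnion (fun j => P.side (σ j)))

/-- The permutation `(k, 1, …, k-1, k+1, …, m)`: first `k`, then the others in increasing order. -/
def startPerm (k : Fin m) : Equiv.Perm (Fin m) :=
  (Fin.cycleRange k).symm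

/-- The maximum of the expression over the `m` permutations
`(1, 2, …, m), (2, 1, 3, …, m), …, (m, 1, …, m-1)`. -/
def startBound [NeZero m] (P : Instance m s) : ℝ :=
  Finset.univ.sup' Finset.univ_nonempty (fun k : Fin m => permBound P (startPerm k))

end IndexCoding

end

namespace IndexCoding

open Finset

/-! ### Entropies of sub-vectors are cardinalities -/

/-! For independent uniform bits H(A | B) is the number of bits of A outside B, so the theorem
reduces to counting.

Converse, for every order σ (`Code.one_sub_errorProb_le`, `Achievable.permBound_le`): the
permutation bound counts each bit at its first demander, provided no decoder up to there has it as
side information. A codeword together with the uncounted bits determines a correctly decoded block,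
by running the decoders in the order σ. Hence M is at least about 2^(n · number of counted bits).

Achievability (`achievable_allocRate`): a block of n copies of one source bit is a symbol of the
field with 2^n elements. For each I, as many power sums of U_I are sent as a decoder in I can lack
symbols of U_I; Vandermonde invertibility gives zero-error decoding.

Matching (`NoExcessAfterStep1.allocRate_le`): without excess bits, all decoders in I ≠ [m] lack
equally many bits of U_I, so the maximum is attained at the first decoder of I in any order. For I =
[m] it is attained by starting the order with a maximizer. The bits of U_I lacked by the first
decoder of I are all counted, and the U_I are disjoint, so the Step 1 rate is at most the
permutation bound. -/

theorem card_restrict_eq {s : ℕ} (A : Finset (Fin s)) (w : Fin s → Bool) :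
    (univ.filter fun w' : Fin s → Bool => A.restrict w' = A.restrict w).card = 2 ^ Aᶜ.card := by
  classical
  have h : (univ.filter fun w' : Fin s → Bool => A.restrict w' = A.restrict w) =
      Fintype.piFinset (fun a => if a ∈ A then {w a} else (univ : Finset Bool)) := by
    ext w'
    simp only [mem_filter, mem_univ, true_and, Fintype.mem_piFinset, funext_iff,
      Finset.restrict, Subtype.forall]
    refine forall_congr' fun a => ?_
    by_cases ha : a ∈ A <;> simp [ha]
  rw [h, Fintype.card_piFinset]
  have h2 : ∀ a, (if a ∈ A then {w a} else (univ : Finset Bool)).card =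
      if a ∈ Aᶜ then 2 else 1 := by
    intro a
    by_cases ha : a ∈ A <;> simp [ha]
  simp_rw [h2]
  rw [Finset.prod_ite_mem]
  simp

theorem prob_restrict_eq {s : ℕ} (A : Finset (Fin s)) (w : Fin s → Bool) :
    prob (fun w' : Fin s → Bool => A.restrict w' = A.restrict w) = 2 ^ Aᶜ.card / 2 ^ s := by
  classical
  unfold prob
  have h : (@Finset.filter _ (fun w' : Fin s → Bool => A.restrict w' = A.restrict w)
      (fun _ => Classical.propDecidable _) univ).card = 2 ^ Aᶜ.card := by
    convert card_restrict_eq A w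
  rw [h]
  simp

theorem restrict_union_eq_iff {s : ℕ} (A B : Finset (Fin s)) (w w' : Fin s → Bool) :
    (A.restrict w' = A.restrict w ∧ B.restrict w' = B.restrict w) ↔
      (A ∪ B).restrict w' = (A ∪ B).restrict w := by
  simp only [funext_iff, Finset.restrict, Subtype.forall, mem_union]
  exact ⟨fun h a ha => ha.elim (h.1 a) (h.2 a), fun h => ⟨fun a ha => h a (.inl ha),
    fun a ha => h a (.inr ha)⟩⟩

/-- The conditional entropy is the mean of the conditional self-information. -/
theorem condEntropy_eq_sum {Ω α β : Type*} [Fintype Ω] [Fintype α] [Fintype β]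
    (X : Ω → α) (Y : Ω → β) :
    condEntropy X Y = (∑ w, -Real.logb 2 (prob (fun w' => X w' = X w ∧ Y w' = Y w) /
      prob (fun w' => Y w' = Y w))) / Fintype.card Ω := by
  classical
  unfold condEntropy
  have h : ∀ (y : β) (x : α), -(prob (fun w => X w = x ∧ Y w = y) *
      Real.logb 2 (prob (fun w => X w = x ∧ Y w = y) / prob (fun w => Y w = y))) =
      (∑ w, if X w = x ∧ Y w = y then -Real.logb 2 (prob (fun w => X w = x ∧ Y w = y) /
        prob (fun w => Y w = y)) else 0) / Fintype.card Ω := by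
    intro y x
    rw [← Finset.sum_filter, Finset.sum_const, nsmul_eq_mul]
    conv_lhs => enter [1, 1]; unfold prob
    have : (univ.filter fun w => X w = x ∧ Y w = y).card =
      (@Finset.filter _ (fun w => X w = x ∧ Y w = y) (fun _ => Classical.propDecidable _) univ).card := by
      congr!
    rw [← this]
    ring
  simp_rw [h, ← Finset.sum_div]
  congr 1
  simp_rw [Finset.sum_comm (t := (univ : Finset Ω))]
  refine Finset.sum_congr rfl fun w _ => ?_
  rw [Finset.sum_eq_single (Y w), Finset.sum_eq_single (X w)]
  · simp
  · intro x _ hx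
    rw [if_neg]
    exact fun h => hx h.1.symm
  · simp
  · intro y _ hy
    refine Finset.sum_eq_zero fun x _ => ?_
    rw [if_neg]
    exact fun h => hy h.2.symm
  · simp

/-- The conditional probability of every outcome is the same power of two, so the self-information
is constant. -/
theorem bitEntropy_eq_card {s : ℕ} (A B : Finset (Fin s)) :
    bitEntropy A B = (A \ B).card := by
  unfold bitEntropy
  rw [condEntropy_eq_sum]
  have hc : Bᶜ.card = (A \ B).card + (A ∪ B)ᶜ.card := by
    rw [← card_union_of_disjoint]
    · congr 1
      ext b
      simp only [mem_compl, mem_union, Finset.mem_sdiff]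
      tauto
    · rw [Finset.disjoint_left]
      intro b
      simp only [mem_compl, mem_union, Finset.mem_sdiff]
      tauto
  have h : ∀ w : Fin s → Bool,
      -Real.logb 2 (prob (fun w' : Fin s → Bool => A.restrict w' = A.restrict w ∧
        B.restrict w' = B.restrict w) / prob (fun w' : Fin s → Bool => B.restrict w' = B.restrict w)) = (A \ B).card := by
    intro w
    simp_rw [restrict_union_eq_iff, prob_restrict_eq, hc]
    have : ((2 : ℝ) ^ (A ∪ B)ᶜ.card / 2 ^ s) / (2 ^ ((A \ B).card + (A ∪ B)ᶜ.card) / 2 ^ s) =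
        (2 ^ (A \ B).card)⁻¹ := by
      rw [pow_add]
      field_simp
    rw [this, Real.logb_inv, neg_neg, Real.logb_pow]
    simp
  simp_rw [h]
  simp

variable {m s : ℕ}

/-! ### The converse -/

/-- The new bits that the `k`-th decoder in the order `σ` contributes. -/
def newBits (P : Instance m s) (σ : Equiv.Perm (Fin m)) (k : Fin m) : Finset (Fin s) :=
  P.demand (σ k) \ ((Finset.Iio k).biUnion (fun j => P.demand (σ j)) ∪
    (Finset.Iic k).biUnion (fun j => P.side (σ j)))

/-- All bits counted by `permBound`. -/
def countedBits (P : Instance m s) (σ : Equiv.Perm (Fin m)) : Finset (Fin s) :=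
  univ.biUnion (newBits P σ)

theorem mem_newBits {P : Instance m s} {σ : Equiv.Perm (Fin m)} {k : Fin m} {b : Fin s} :
    b ∈ newBits P σ k ↔ b ∈ P.demand (σ k) ∧ (∀ j < k, b ∉ P.demand (σ j)) ∧
      ∀ j ≤ k, b ∉ P.side (σ j) := by
  simp [newBits, not_or]

theorem permBound_eq_card (P : Instance m s) (σ : Equiv.Perm (Fin m)) :
    permBound P σ = (countedBits P σ).card := by
  unfold permBound countedBits
  rw [card_biUnion]
  · simp [bitEntropy_eq_card, newBits]
  · have key : ∀ k l, k < l → Disjoint (newBits P σ k) (newBits P σ l) := by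
      intro k l hkl
      rw [Finset.disjoint_left]
      intro b hk hl
      exact (mem_newBits.1 hl).2.1 k hkl (mem_newBits.1 hk).1
    intro k _ l _ hkl
    rcases lt_or_gt_of_ne hkl with h | h
    · exact key k l h
    · exact (key l k h).symm

/-- All decoders reproduce their demands on the source block `x`. -/
def Code.Correct {P : Instance m s} {n M : ℕ} (c : Code P n M) (x : Fin n → Fin s → Bool) : Prop :=
  ∀ i : Fin m, c.dec i (c.enc x) (fun t => (P.side i).restrict (x t)) =
      fun t => (P.demand i).restrict (x t)

/-- Induction along σ: when the turn of a decoder comes, its side information is already known, so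
its demand follows from the codeword. Every bit is demanded by someone. -/
theorem Code.Correct.eq_of_enc_eq {P : Instance m s} {n M : ℕ} {c : Code P n M}
    (σ : Equiv.Perm (Fin m)) {x x' : Fin n → Fin s → Bool} (hx : c.Correct x) (hx' : c.Correct x')
    (henc : c.enc x = c.enc x') (hD : ∀ t, ∀ b ∉ countedBits P σ, x t b = x' t b) : x = x' := by
  have key : ∀ k : Fin m, ∀ t, ∀ b ∈ P.demand (σ k), x t b = x' t b := by
    intro k
    induction k using WellFoundedLT.induction with
    | ind k ih =>
    have hside : ∀ t, ∀ b ∈ P.side (σ k), x t b = x' t b := by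
      intro t b hb
      by_cases hbD : b ∈ countedBits P σ
      · obtain ⟨k', -, hk'⟩ := mem_biUnion.1 hbD
        rw [mem_newBits] at hk'
        -- A bit counted at k' is in no side information up to position k', so it can only become
        -- side information later.
        have : k' < k := by
          by_contra h
          exact hk'.2.2 k (not_lt.1 h) hb
        exact ih k' this t b hk'.1
      · exact hD t b hbD
    have hs : (fun t => (P.side (σ k)).restrict (x t)) =
        fun t => (P.side (σ k)).restrict (x' t) := by
      funext t b
      exact hside t b b.2
    have : (fun t => (P.demand (σ k)).restrict (x t)) =
        fun t => (P.demand (σ k)).restrict (x' t) := by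
      rw [← hx (σ k), henc, hs]
      exact hx' (σ k)
    intro t b hb
    exact congrFun (congrFun this t) ⟨b, hb⟩
  funext t b
  obtain ⟨i, hi⟩ := P.exists_demand b
  exact key (σ.symm i) t b (by simpa using hi)

theorem Code.one_sub_errorProb_le {P : Instance m s} {n M : ℕ} (c : Code P n M)
    (σ : Equiv.Perm (Fin m)) :
    (1 - c.errorProb) * 2 ^ ((countedBits P σ).card * n) ≤ M := by
  classical
  have hcard : (univ.filter c.Correct).card ≤ M * 2 ^ ((countedBits P σ)ᶜ.card * n) := by
    have := Finset.card_le_card_of_injOn (s := univ.filter c.Correct)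
      (t := (univ : Finset (Fin M × (Fin n → ((countedBits P σ)ᶜ : Finset (Fin s)) → Bool))))
      (fun x => (c.enc x, fun t => ((countedBits P σ)ᶜ).restrict (x t))) (by simp) (by
        intro x hx x' hx' h
        simp only [Prod.mk.injEq] at h
        refine Code.Correct.eq_of_enc_eq σ (c := c) (by simpa using hx) (by simpa using hx') h.1 ?_
        intro t b hb
        exact congrFun (congrFun h.2 t) ⟨b, by simpa using hb⟩)
    refine this.trans_eq ?_
    rw [card_univ, Fintype.card_prod]
    simp only [Fintype.card_fin, Fintype.card_fun, Fintype.card_bool, Fintype.card_coe]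
    rw [pow_mul]
  have herr : c.errorProb =
      ((univ.filter fun x => ¬ c.Correct x).card : ℝ) / (2 ^ (s * n) : ℝ) := by
    unfold Code.errorProb prob
    congr 1
    · norm_cast
      congr! 2 with x
      simp [Code.Correct]
    · simp [pow_mul]
  have htot : (univ.filter c.Correct).card + (univ.filter fun x => ¬ c.Correct x).card =
      2 ^ (s * n) := by
    rw [Finset.card_filter_add_card_filter_not]
    simp [pow_mul]
  have htot' : ((univ.filter c.Correct).card : ℝ) + (univ.filter fun x => ¬ c.Correct x).card =
      2 ^ (s * n) := by exact_mod_cast htot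
  have h1 : 1 - c.errorProb = ((univ.filter c.Correct).card : ℝ) / 2 ^ (s * n) := by
    rw [herr, ← htot', eq_div_iff, sub_mul, div_mul_cancel₀]
    · ring
    all_goals rw [htot']; positivity
  have hsn : s * n = (countedBits P σ).card * n + (countedBits P σ)ᶜ.card * n := by
    rw [← add_mul, Finset.card_add_card_compl, Fintype.card_fin]
  have hcard' : ((univ.filter c.Correct).card : ℝ) ≤ M * 2 ^ ((countedBits P σ)ᶜ.card * n) := by
    exact_mod_cast hcard
  rw [h1, hsn, pow_add, div_mul_eq_mul_div, div_le_iff₀ (by positivity)]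
  calc _ ≤ (M * 2 ^ ((countedBits P σ)ᶜ.card * n)) * (2 : ℝ) ^ ((countedBits P σ).card * n) := by
        gcongr
    _ = _ := by ring

theorem Achievable.permBound_le {P : Instance m s} {R : ℝ} (hR : Achievable P R)
    (σ : Equiv.Perm (Fin m)) : permBound P σ ≤ R := by
  obtain ⟨M, c, hM, hlim⟩ := hR
  rw [permBound_eq_card]
  set d := (countedBits P σ).card
  have hev : ∀ᶠ n : ℕ in atTop, (d : ℝ) - 1 / n ≤ R := by
    -- Error below 1/2 loses at most a factor 2 in M, hence at most 1/n in rate.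
    filter_upwards [hlim.eventually (gt_mem_nhds (show (0 : ℝ) < 1 / 2 by norm_num)),
      eventually_ge_atTop 1] with n hn hn1
    have hn0 : (0 : ℝ) < n := by exact_mod_cast hn1
    refine le_trans ?_ (hM n hn1)
    have h := (c n).one_sub_errorProb_le σ
    have h2 : (2 : ℝ) ^ ((d * n : ℝ) - 1) ≤ M n := by
      rw [Real.rpow_sub_one (by norm_num)]
      have : (2 : ℝ) ^ (d * n : ℝ) = 2 ^ (d * n) := by
        rw [← Real.rpow_natCast]; push_cast; rfl
      rw [this]
      refine le_trans ?_ h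
      have : (0 : ℝ) < 2 ^ (d * n) := by positivity
      nlinarith
    have h3 : (d * n : ℝ) - 1 ≤ Real.logb 2 (M n) := by
      rw [Real.le_logb_iff_rpow_le (by norm_num)
        (lt_of_lt_of_le (by positivity) h2)]
      exact h2
    rw [le_div_iff₀ hn0, sub_mul, one_div, inv_mul_cancel₀ hn0.ne']
    exact h3
  have hl : Tendsto (fun n : ℕ => (d : ℝ) - 1 / n) atTop (𝓝 ((d : ℝ) - 0)) :=
    tendsto_const_nhds.sub tendsto_one_div_atTop_nhds_zero_nat
  rw [sub_zero] at hl
  exact le_of_tendsto hl hev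

/-! ### Achievability by Reed–Solomon codes -/

/-- A vector supported on at most `c` positions is determined by its first `c` power sums. -/
theorem eq_zero_of_sum_pow_mul_eq_zero {F ι : Type*} [Field F] (W : Finset ι)
    {α : ι → F} (hα : Function.Injective α) {c : ℕ} (hc : W.card ≤ c) (d : ι → F)
    (h : ∀ j : Fin c, ∑ b ∈ W, α b ^ (j : ℕ) * d b = 0) : ∀ b ∈ W, d b = 0 := by
  let e := W.equivFin
  have h1 : (fun i : Fin W.card => d (e.symm i)) = 0 := by
    refine Matrix.eq_zero_of_forall_pow_sum_mul_pow_eq_zero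
      (f := fun i : Fin W.card => α (e.symm i)) ?_ ?_
    · intro i j hij
      exact e.symm.injective (Subtype.ext (hα hij))
    · intro j
      rw [← h ⟨j, j.2.trans_le hc⟩, ← Finset.sum_coe_sort W, ← e.symm.sum_comp]
      exact Finset.sum_congr rfl fun i _ => mul_comm _ _
  intro b hb
  simpa using congrFun h1 (e ⟨b, hb⟩)

theorem prob_eq_zero {Ω : Type*} [Fintype Ω] {E : Ω → Prop} (h : ∀ w, ¬ E w) : prob E = 0 := by
  simp [prob, h]

/-- An encoder whose output together with the side information determines the demands yields a
code without errors. -/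
theorem exists_code_errorProb_eq_zero (P : Instance m s) {n M : ℕ}
    (enc : (Fin n → Fin s → Bool) → Fin M)
    (h : ∀ i x x', enc x = enc x' → (∀ t, ∀ b ∈ P.side i, x t b = x' t b) →
      ∀ t, ∀ b ∈ P.demand i, x t b = x' t b) :
    ∃ c : Code P n M, c.errorProb = 0 := by
  classical
  -- Any source block consistent with the observation serves; the default is never reached on a
  -- genuine transmission.
  let dec : (i : Fin m) → Fin M → (Fin n → P.side i → Bool) → (Fin n → P.demand i → Bool) :=
    fun i a y => if hx : ∃ x, enc x = a ∧ (fun t => (P.side i).restrict (x t)) = y then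
      fun t => (P.demand i).restrict (hx.choose t) else fun _ _ => false
  refine ⟨⟨enc, dec⟩, ?_⟩
  refine prob_eq_zero ?_
  rintro x ⟨i, hi⟩
  refine hi ?_
  have hx : ∃ x', enc x' = enc x ∧ (fun t => (P.side i).restrict (x' t)) =
      fun t => (P.side i).restrict (x t) := ⟨x, rfl, rfl⟩
  simp only [dec]
  rw [dif_pos hx]
  obtain ⟨h1, h2⟩ := hx.choose_spec
  funext t b
  exact h i _ _ h1 (fun t b hb => congrFun (congrFun h2 t) ⟨b, hb⟩) t b b.2

/-- The largest number of bits of `U_I` that a decoder in `I` lacks. -/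
def maxLack (P : Instance m s) (U : Finset (Fin m) → Finset (Fin s)) (I : Finset (Fin m)) : ℕ :=
  I.sup fun i => (U I \ P.side i).card

theorem allocRate_eq_sum_maxLack (P : Instance m s) (U : Finset (Fin m) → Finset (Fin s)) :
    allocRate P U = ∑ I : {I : Finset (Fin m) // I.Nonempty}, (maxLack P U I.1 : ℝ) := by
  unfold allocRate
  refine Finset.sum_congr rfl fun I _ => ?_
  simp_rw [bitEntropy_eq_card, maxLack]
  rw [← Finset.sup'_eq_sup I.2]
  exact (Finset.apply_sup'_eq_sup'_comp I.2 (Nat.cast : ℕ → ℝ) Nat.cast_max).symm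

/-- The bound s ≤ 2^n provides a distinct evaluation point for each source bit. Two blocks with the
same codeword and side information differ, within U_I, only on the lacked symbols, and these are few
enough for the power sums to force equality. -/
theorem exists_zero_error_code (P : Instance m s) (U : Finset (Fin m) → Finset (Fin s))
    (hU : ∀ i, ∀ b ∈ P.demand i, ∃ I, i ∈ I ∧ b ∈ U I) {n : ℕ} (hn : n ≠ 0) (hs : s ≤ 2 ^ n) :
    ∃ c : Code P n (2 ^ (n * ∑ I : {I : Finset (Fin m) // I.Nonempty}, maxLack P U I.1)),
      c.errorProb = 0 := by
  classical
  let F := GaloisField 2 n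
  have : Fintype F := Fintype.ofFinite F
  have hF : Fintype.card F = 2 ^ n := by
    rw [← Nat.card_eq_fintype_card]
    exact GaloisField.card 2 n hn
  obtain ⟨e⟩ : Nonempty ((Fin n → Bool) ≃ F) := by
    rw [← Fintype.card_eq, hF]; simp
  obtain ⟨α⟩ : Nonempty (Fin s ↪ F) := by
    rw [Function.Embedding.nonempty_iff_card_le, hF]; simpa using hs
  obtain ⟨g⟩ : Nonempty (((Σ I : {I : Finset (Fin m) // I.Nonempty}, Fin (maxLack P U I.1)) → F) ≃
      Fin (2 ^ (n * ∑ I : {I : Finset (Fin m) // I.Nonempty}, maxLack P U I.1))) := by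
    rw [← Fintype.card_eq]
    simp [hF, pow_mul]
  refine exists_code_errorProb_eq_zero P
    (fun x => g fun p => ∑ b ∈ U p.1.1, α b ^ (p.2 : ℕ) * e (fun t => x t b)) ?_
  intro i x x' henc hside t b hb
  obtain ⟨I, hiI, hbI⟩ := hU i b hb
  have henc' := g.injective henc
  let d : Fin s → F := fun b => e (fun t => x t b) - e (fun t => x' t b)
  have hd : ∀ b ∈ P.side i, d b = 0 := by
    intro b hb
    simp only [d]
    rw [sub_eq_zero]
    congr 1
    funext t
    exact hside t b hb
  have h0 := eq_zero_of_sum_pow_mul_eq_zero (U I \ P.side i) α.injective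
    (c := maxLack P U I) (Finset.le_sup (f := fun i => (U I \ P.side i).card) hiI) d (by
      intro j
      have h1 := congrFun henc' ⟨⟨I, ⟨i, hiI⟩⟩, j⟩
      simp only at h1
      rw [← sub_eq_zero, ← Finset.sum_sub_distrib] at h1
      rw [← h1]
      simp_rw [← mul_sub]
      refine Finset.sum_subset Finset.sdiff_subset fun b hb hb' => ?_
      rw [hd b (by simpa [hb] using hb'), mul_zero])
  have hbs : b ∉ P.side i := Finset.disjoint_left.1 (P.demand_disjoint_side i) hb
  have := h0 b (by simp [hbI, hbs])
  exact congrFun (e.injective (sub_eq_zero.1 this)) t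

theorem achievable_allocRate (P : Instance m s) (U : Finset (Fin m) → Finset (Fin s))
    (hU : ∀ i, ∀ b ∈ P.demand i, ∃ I, i ∈ I ∧ b ∈ U I) : Achievable P (allocRate P U) := by
  classical
  rw [allocRate_eq_sum_maxLack]
  set r := ∑ I : {I : Finset (Fin m) // I.Nonempty}, maxLack P U I.1 with hr
  -- For small n the field may have too few elements; a constant code of the same size serves there,
  -- since only the limit of the error matters.
  have key : ∀ n : ℕ, ∃ c : Code P n (2 ^ (n * r)), s < n → c.errorProb = 0 := by
    intro n
    by_cases hn : s < n
    · obtain ⟨c, hc⟩ := exists_zero_error_code P U hU (n := n) (by omega)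
        (hn.le.trans Nat.lt_two_pow_self.le)
      exact ⟨c, fun _ => hc⟩
    · exact ⟨⟨fun _ => ⟨0, by positivity⟩, fun _ _ _ _ _ => false⟩, fun h => absurd h hn⟩
  choose c hc using key
  refine ⟨fun n => 2 ^ (n * r), c, fun n hn => ?_, ?_⟩
  · have hn0 : (0 : ℝ) < n := by exact_mod_cast hn
    push_cast
    rw [Real.logb_pow, Real.logb_self_eq_one (by norm_num), div_le_iff₀ hn0, hr]
    push_cast
    exact le_of_eq (by ring)
  · refine tendsto_const_nhds.congr' ?_
    filter_upwards [eventually_gt_atTop s] with n hn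
    exact (hc n hn).symm

/-! ### Step 1 without excess bits -/

theorem exists_isLeast_of_nonempty {k : ℕ} {S : Set (Fin k)} (hS : S.Nonempty) :
    ∃ a, IsLeast S a := by
  obtain ⟨a, ha, h⟩ := WellFounded.has_min (wellFounded_lt (α := Fin k)) S hS
  exact ⟨a, ha, fun b hb => not_lt.1 (h b hb)⟩

/-- As i and j are interchangeable, this is an equality. A strict inequality would separate the
extreme decoders, and the one lacking more would lack a bit that the other has: an excess bit. -/
theorem NoExcessAfterStep1.card_le {P : Instance m s} (hP : NoExcessAfterStep1 P)
    {I : Finset (Fin m)} (hI : I ≠ univ) {i j : Fin m} (hi : i ∈ I) (hj : j ∈ I) :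
    (step1 P I \ P.side j).card ≤ (step1 P I \ P.side i).card := by
  by_contra! hlt
  obtain ⟨i₁, hi₁, hmin⟩ := I.exists_min_image
    (fun l => bitEntropy (step1 P I) (P.side l)) ⟨i, hi⟩
  obtain ⟨j₁, hj₁, hmax⟩ := I.exists_max_image
    (fun l => bitEntropy (step1 P I) (P.side l)) ⟨i, hi⟩
  obtain ⟨i₀, hi₀⟩ := exists_isLeast_of_nonempty (S := {i | i ∈ I ∧ ∀ l ∈ I,
    bitEntropy (step1 P I) (P.side i) ≤ bitEntropy (step1 P I) (P.side l)}) ⟨i₁, hi₁, hmin⟩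
  obtain ⟨j₀, hj₀⟩ := exists_isLeast_of_nonempty (S := {j | j ∈ I ∧ ∀ l ∈ I,
    bitEntropy (step1 P I) (P.side l) ≤ bitEntropy (step1 P I) (P.side j)}) ⟨j₁, hj₁, hmax⟩
  have hlt' : bitEntropy (step1 P I) (P.side i₀) < bitEntropy (step1 P I) (P.side j₀) :=
    (hi₀.1.2 i hi).trans_lt (lt_of_lt_of_le
      (by rw [bitEntropy_eq_card, bitEntropy_eq_card]; exact_mod_cast hlt) (hj₀.1.2 j hj))
  obtain ⟨b, hb⟩ : ∃ b, b ∈ step1 P I ∧ b ∈ P.side i₀ ∧ b ∉ P.side j₀ := by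
    by_contra! h
    rw [bitEntropy_eq_card, bitEntropy_eq_card, Nat.cast_lt] at hlt'
    refine hlt'.not_ge (Finset.card_le_card fun b hb => ?_)
    rw [Finset.mem_sdiff] at hb ⊢
    exact ⟨hb.1, fun hbi => hb.2 (h b hb.1 hbi)⟩
  obtain ⟨b₀, hb₀⟩ := exists_isLeast_of_nonempty
    (S := {b | b ∈ step1 P I ∧ b ∈ P.side i₀ ∧ b ∉ P.side j₀}) ⟨b, hb⟩
  exact hP I b₀ ⟨hI, i₀, j₀, hi₀, hj₀, hlt', hb₀⟩

/-- If `σ k` is the first decoder of `I` in the order `σ`, then all bits of `U_I` that it lacks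
are counted. -/
theorem step1_sdiff_subset_countedBits (P : Instance m s) (σ : Equiv.Perm (Fin m))
    {I : Finset (Fin m)} {k : Fin m} (hk : σ k ∈ I) (hmin : ∀ j < k, σ j ∉ I) :
    step1 P I \ P.side (σ k) ⊆ countedBits P σ := by
  intro b hb
  rw [Finset.mem_sdiff, step1, mem_filter] at hb
  obtain ⟨⟨-, hbI⟩, hbk⟩ := hb
  simp only [countedBits, mem_biUnion, mem_univ, true_and, mem_newBits]
  unfold step1Index at hbI
  split_ifs at hbI with hJ
  · have hside : ∀ i, b ∉ P.side i := by
      intro i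
      have : i ∈ lackers P b := hJ ▸ mem_univ i
      simpa [lackers] using this
    -- Nobody has b as side information, so b is counted at its first demander, which need not be k.
    obtain ⟨i, hi⟩ := P.exists_demand b
    obtain ⟨k₀, hk₀⟩ := exists_isLeast_of_nonempty (S := {l | b ∈ P.demand (σ l)})
      ⟨σ.symm i, by simpa using hi⟩
    exact ⟨k₀, hk₀.1, fun j hj hbj => (hk₀.2 hbj).not_gt hj, fun j _ => hside _⟩
  · have hI : ∀ i, i ∈ I ↔ b ∈ P.demand i ∨ b ∈ P.side i := by
      intro i
      simp [← hbI, demanders, lackers]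
    -- I consists of the decoders that demand or have b: σ k lacks b, hence demands it, and the
    -- earlier decoders, being outside I, do neither.
    refine ⟨k, ((hI _).1 hk).resolve_right hbk,
      fun j hj hbj => hmin j hj ((hI _).2 (.inl hbj)), fun j hj hbj => ?_⟩
    rcases hj.lt_or_eq with hj | rfl
    · exact hmin j hj ((hI _).2 (.inr hbj))
    · exact hbk hbj

theorem mem_step1Index_of_mem_demand {P : Instance m s} {i : Fin m} {b : Fin s}
    (hb : b ∈ P.demand i) : i ∈ step1Index P b := by
  unfold step1Index
  split_ifs
  · exact mem_univ i
  · simp [demanders, hb]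

theorem NoExcessAfterStep1.allocRate_le [NeZero m] {P : Instance m s}
    (hP : NoExcessAfterStep1 P) : allocRate P (step1 P) ≤ startBound P := by
  classical
  -- The message U_[m] is exempt from the excess condition, so the order has to start with a decoder
  -- that lacks the most of it; the rest of the order is irrelevant.
  obtain ⟨k, -, hk⟩ := (univ : Finset (Fin m)).exists_max_image
    (fun l => (step1 P univ \ P.side l).card) univ_nonempty
  refine le_trans ?_ (Finset.le_sup' (fun k : Fin m => permBound P (startPerm k)) (mem_univ k))
  have h0 : startPerm k 0 = k := by simp [startPerm]
  generalize startPerm k = σ at h0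
  rw [allocRate_eq_sum_maxLack, permBound_eq_card, ← Nat.cast_sum, Nat.cast_le]
  have hsub : ∀ I : {I : Finset (Fin m) // I.Nonempty},
      maxLack P (step1 P) I.1 ≤ (countedBits P σ ∩ step1 P I.1).card := by
    rintro ⟨I, hI⟩
    obtain ⟨i, hi⟩ := hI
    obtain ⟨t, ht⟩ := exists_isLeast_of_nonempty (S := {l | σ l ∈ I})
      ⟨σ.symm i, by simpa using hi⟩
    refine Finset.sup_le fun j hj => ?_
    have h1 : (step1 P I \ P.side j).card ≤ (step1 P I \ P.side (σ t)).card := by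
      by_cases hIu : I = univ
      · subst hIu
        have : t = 0 := le_antisymm (ht.2 (by simp)) (Fin.zero_le t)
        rw [this, h0]
        exact hk j (mem_univ j)
      · exact hP.card_le hIu ht.1 hj
    refine h1.trans (Finset.card_le_card (Finset.subset_inter ?_ Finset.sdiff_subset))
    exact step1_sdiff_subset_countedBits P σ ht.1 fun j hj hjI => (ht.2 hjI).not_gt hj
  refine (Finset.sum_le_sum fun I _ => hsub I).trans ?_
  -- Step 1 puts each bit into a single message, so the counted bits are not counted twice.
  rw [← Finset.card_biUnion]
  · exact Finset.card_le_card (Finset.biUnion_subset.2 fun I _ => Finset.inter_subset_left)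
  · intro I _ I' _ hne
    refine Finset.disjoint_left.2 fun b hb hb' => hne (Subtype.ext ?_)
    simp only [step1, mem_inter, mem_filter, mem_univ, true_and] at hb hb'
    rw [← hb.2, ← hb'.2]

end IndexCoding

theorem mainTheorem5 {m s : ℕ} [NeZero m] (P : IndexCoding.Instance m s)
    (hP : IndexCoding.NoExcessAfterStep1 P) :
    IsGLB {R : ℝ | IndexCoding.Achievable P R} (IndexCoding.optimalRate P) ∧
    IndexCoding.allocRate P (IndexCoding.step1 P) = IndexCoding.optimalRate P ∧
    IndexCoding.optimalRate P = IndexCoding.startBound P := by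
  have hach : IndexCoding.Achievable P (IndexCoding.allocRate P (IndexCoding.step1 P)) :=
    IndexCoding.achievable_allocRate P _ fun i b hb => ⟨IndexCoding.step1Index P b,
      IndexCoding.mem_step1Index_of_mem_demand hb, by simp [IndexCoding.step1]⟩
  have hconv : ∀ R, IndexCoding.Achievable P R → IndexCoding.startBound P ≤ R := fun R hR =>
    Finset.sup'_le _ _ fun k _ => hR.permBound_le _
  have hle := hP.allocRate_le
  -- The Step 1 rate is itself achievable, so the infimum is attained and `sInf` does not take a
  -- default value.
  have hleast : IsLeast {R : ℝ | IndexCoding.Achievable P R}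
      (IndexCoding.allocRate P (IndexCoding.step1 P)) :=
    ⟨hach, fun R hR => hle.trans (hconv R hR)⟩
  have hopt : IndexCoding.optimalRate P = IndexCoding.allocRate P (IndexCoding.step1 P) :=
    hleast.csInf_eq
  exact ⟨hopt ▸ hleast.isGLB, hopt.symm, hopt.trans (le_antisymm hle (hconv _ hach))⟩
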